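/- Consider a group-server queue: customers arrive according to a Poisson process with rate $\lambda>0$; there are $K$ groups of parallel servers, group $k$ having $M_k$ servers with exponential service times of rate $\mu_k>0$ and operating cost rate $c_k\ge 0$ per working server. The state $n\in\mathbb N$ is the number of customers in the system. The holding cost rate $h:\mathbb N\to\mathbb R$ is (weakly) increasing and convex, with $h(n)\to\infty$ as $n\to\infty$; turning servers on and off is free and customers can migrate freely between servers. An efficient stationary policy $d$ assigns to each state $n$ numbers $d(n,k)$ of working servers with $0\le d(n,k)\le M_k$ and $\sum_k d(n,k)\le n$; under $d$ the number of customers $n_t$ is the birth-death process with birth rate $\lambda$ and death rate $\sum_k d(n,k)\mu_k$ at state $n$. The policy has finite long-run average cost $\eta$ from an initial state $n_0$ if the expected cost rate $\mathbb E[h(n_t)+\sum_k d(n_t,k)c_k \mid n_0]$ is finite for every $t\ge 0$ and integrable over $[0,T]$ for every $T>0$, and $$\eta=\lim_{T\to\infty}\mathbb E\Big\{\frac1T\int_0^T\Big[h(n_t)+\sum_k d(n_t,k)\,c_k\Big]dt\,\Big|\,n_0\Big\}.$$ A policy is optimal in a class of efficient policies if it belongs to the class and, from every initial state, has a finite long-run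 average cost that does not exceed any finite long-run average cost, from that state, of a policy in the class. Let $d^*$ be optimal in the class of all efficient policies, and suppose that at some state $\bar n$ it turns on all servers of all groups: $d^*(\bar n,k)=M_k$ for all $k$. Then $d^*(n,k)=M_k$ for all $k$ and all $n\ge\bar n$. Consequently the search for an optimal policy can be truncated to the states $n<\bar n$: the class of efficient policies $d$ with $d(n,k)=M_k$ for all $k$ and all $n\ge\bar n$ is finite (and contains $d^*$), and every policy that is optimal in this class is optimal in the class of all efficient policies. -/

import Mathlib

open Filter Topology

/-- The data of a group-server queue with `K` groups: Poisson arrivals with rate `arrivalRate`;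
group `k` has `servers k` exponential servers, each of which, when it is on, works at rate
`serviceRate k` and costs `operatingCost k` per unit of time; `holdingCost n` is the cost rate of
having `n` customers in the system. -/
structure GroupServerQueue (K : ℕ) where
  arrivalRate : ℝ
  servers : Fin K → ℕ
  serviceRate : Fin K → ℝ
  operatingCost : Fin K → ℝ
  holdingCost : ℕ → ℝ

namespace GroupServerQueue

variable {K : ℕ} (Q : GroupServerQueue K)

/-- The efficient stationary policies: `d n k` is the number of working servers of group `k` when
there are `n` customers; at most `servers k` of them, and never more than `n` in total. -/
def efficientPolicies : Set (ℕ → Fin K → ℕ) :=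
  {d | ∀ n, (∀ k, d n k ≤ Q.servers k) ∧ ∑ k, d n k ≤ n}

/-- The efficient policies that turn on all servers at every state `n ≥ N`. -/
def truncatedPolicies (N : ℕ) : Set (ℕ → Fin K → ℕ) :=
  {d | d ∈ Q.efficientPolicies ∧ ∀ n, N ≤ n → ∀ k, d n k = Q.servers k}

/-- Total service rate of the action `m`. -/
noncomputable def totalRate (m : Fin K → ℕ) : ℝ := ∑ k, (m k : ℝ) * Q.serviceRate k

/-- Total cost rate at state `n` under the action `m`. -/
noncomputable def costRate (n : ℕ) (m : Fin K → ℕ) : ℝ :=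
  Q.holdingCost n + ∑ k, (m k : ℝ) * Q.operatingCost k

/-- Infinitesimal generator of the birth-death process of the number of customers under the
policy `d`. (An efficient policy has no working server at state `0`.) -/
noncomputable def generator (d : ℕ → Fin K → ℕ) (i j : ℕ) : ℝ :=
  if j = i + 1 then Q.arrivalRate
  else if i = j + 1 then Q.totalRate (d i)
  else if i = j then -(Q.arrivalRate + Q.totalRate (d i))
  else 0

/-- A bound for all the exit rates of all efficient policies. -/
noncomputable def uniformRate : ℝ := Q.arrivalRate + Q.totalRate Q.servers

/-- One-step matrix `U = I + B / Λ` of the chain uniformized at rate `Λ`, `B` the generator. -/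
noncomputable def uniformized (d : ℕ → Fin K → ℕ) (i j : ℕ) : ℝ :=
  (if i = j then 1 else 0) + Q.generator d i j / Q.uniformRate

/-- The powers of the matrix `U`; its `i`-th row vanishes outside `{0, …, i + 1}`. -/
noncomputable def uniformizedPow (d : ℕ → Fin K → ℕ) : ℕ → ℕ → ℕ → ℝ
  | 0, i, j => if i = j then 1 else 0
  | s + 1, i, j => ∑ l ∈ Finset.range (i + 2), Q.uniformized d i l * uniformizedPow d s l j

/-- Transition function `p_t(i, j) = P(n_t = j | n_0 = i)` of the continuous-time Markov process
with the (bounded) generator `B`, that is, `exp (t B) = ∑_s e^{-Λt} (Λt)^s / s! U^s`. That it is a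
probability for each `t ≥ 0` and `i`, starts at the identity and solves the Kolmogorov backward
equation for `B` is proved in `transition_nonneg`, `hasSum_transition`, `transition_zero`
and `hasDerivAt_transition`. -/
noncomputable def transition (d : ℕ → Fin K → ℕ) (t : ℝ) (i j : ℕ) : ℝ :=
  ∑' s : ℕ, Real.exp (-(Q.uniformRate * t)) * (Q.uniformRate * t) ^ s / (s.factorial : ℝ) *
    Q.uniformizedPow d s i j

/-- The expected cost rate `E (f (n_t, d (n_t)) | n_0 = n₀)` at time `t`. -/
noncomputable def expectedCostRate (d : ℕ → Fin K → ℕ) (n₀ : ℕ) (t : ℝ) : ℝ :=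
  ∑' m : ℕ, Q.transition d t n₀ m * Q.costRate m (d m)

/-- `η` is the (finite) long-run average cost of the policy `d` from the initial state `n₀`: all
the expectations are finite, and `η = lim_{T → ∞} (1 / T) E ∫₀ᵀ f (n_t, d (n_t)) dt`. -/
def HasAverageCost (d : ℕ → Fin K → ℕ) (n₀ : ℕ) (η : ℝ) : Prop :=
  (∀ t, 0 ≤ t → Summable fun m : ℕ => Q.transition d t n₀ m * Q.costRate m (d m)) ∧
  (∀ T, 0 < T → IntervalIntegrable (Q.expectedCostRate d n₀) MeasureTheory.volume 0 T) ∧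
  Tendsto (fun T : ℝ => (1 / T) * ∫ t in (0 : ℝ)..T, Q.expectedCostRate d n₀ t) atTop (𝓝 η)

/-- The policy `d` minimizes the long-run average cost over the class `D` of policies, from every
initial state, with a finite minimum. Policies whose average cost is infinite do not compete. -/
def IsOptimalIn (D : Set (ℕ → Fin K → ℕ)) (d : ℕ → Fin K → ℕ) : Prop :=
  d ∈ D ∧ ∀ n₀ : ℕ, ∃ η : ℝ, Q.HasAverageCost d n₀ η ∧
    ∀ d' ∈ D, ∀ η' : ℝ, Q.HasAverageCost d' n₀ η' → η ≤ η'

/-- Optimality among all efficient policies. -/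
def IsOptimal (d : ℕ → Fin K → ℕ) : Prop := Q.IsOptimalIn Q.efficientPolicies d

section Facts

variable {Q} {d : ℕ → Fin K → ℕ}

lemma totalRate_nonneg (hμ : ∀ k, 0 < Q.serviceRate k) (m : Fin K → ℕ) : 0 ≤ Q.totalRate m :=
  Finset.sum_nonneg fun k _ => mul_nonneg (Nat.cast_nonneg _) (hμ k).le

lemma uniformRate_pos (hl : 0 < Q.arrivalRate) (hμ : ∀ k, 0 < Q.serviceRate k) :
    0 < Q.uniformRate := by
  have := totalRate_nonneg hμ Q.servers
  unfold uniformRate; linarith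

lemma totalRate_zero (hd : d ∈ Q.efficientPolicies) : Q.totalRate (d 0) = 0 := by
  have h := (hd 0).2
  have h0 : ∀ k, d 0 k = 0 := fun k => by
    have := Finset.single_le_sum (f := d 0) (fun i _ => Nat.zero_le _) (Finset.mem_univ k)
    omega
  simp [totalRate, h0]

lemma totalRate_le (hμ : ∀ k, 0 < Q.serviceRate k) (hd : d ∈ Q.efficientPolicies) (n : ℕ) :
    Q.totalRate (d n) ≤ Q.totalRate Q.servers :=
  Finset.sum_le_sum fun k _ =>
    mul_le_mul_of_nonneg_right (by exact_mod_cast (hd n).1 k) (hμ k).le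

lemma generator_row_sum (hd : d ∈ Q.efficientPolicies) (i : ℕ) :
    ∑ l ∈ Finset.range (i + 2), Q.generator d i l = 0 := by
  rcases i with _ | i
  · simp [Finset.sum_range_succ, generator, totalRate_zero hd]
  · rw [Finset.sum_range_succ, Finset.sum_range_succ, Finset.sum_range_succ,
      Finset.sum_eq_zero]
    · simp [generator, show i ≠ i + 1 + 1 by omega]
    · intro l hl
      have := Finset.mem_range.1 hl
      unfold generator
      rw [if_neg (by omega), if_neg (by omega), if_neg (by omega)]

lemma uniformized_nonneg (hl : 0 < Q.arrivalRate) (hμ : ∀ k, 0 < Q.serviceRate k)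
    (hd : d ∈ Q.efficientPolicies) (i j : ℕ) : 0 ≤ Q.uniformized d i j := by
  have hΛ := uniformRate_pos hl hμ
  have h1 := totalRate_nonneg hμ (d i)
  have h2 := totalRate_le hμ hd i
  unfold uniformized generator
  split_ifs <;> try positivity
  rw [← div_self hΛ.ne', ← add_div]
  apply div_nonneg _ hΛ.le
  unfold uniformRate; linarith

lemma uniformized_row_sum (hd : d ∈ Q.efficientPolicies) (i : ℕ) :
    ∑ l ∈ Finset.range (i + 2), Q.uniformized d i l = 1 := by
  simp only [uniformized, Finset.sum_add_distrib, ← Finset.sum_div, generator_row_sum hd]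
  simp

lemma uniformizedPow_nonneg (hl : 0 < Q.arrivalRate) (hμ : ∀ k, 0 < Q.serviceRate k)
    (hd : d ∈ Q.efficientPolicies) (s i j : ℕ) : 0 ≤ Q.uniformizedPow d s i j := by
  induction s generalizing i with
  | zero => unfold uniformizedPow; split_ifs <;> norm_num
  | succ s ih =>
    unfold uniformizedPow
    exact Finset.sum_nonneg fun l _ => mul_nonneg (uniformized_nonneg hl hμ hd i l) (ih l)

lemma hasSum_uniformizedPow (hd : d ∈ Q.efficientPolicies) (s i : ℕ) :
    HasSum (Q.uniformizedPow d s i) 1 := by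
  induction s generalizing i with
  | zero =>
    have h : Q.uniformizedPow d 0 i = fun j => if j = i then (1 : ℝ) else 0 := by
      funext j; simp [uniformizedPow, eq_comm]
    rw [h]; exact hasSum_ite_eq i 1
  | succ s ih =>
    have := hasSum_sum (s := Finset.range (i + 2)) fun l _ => (ih l).mul_left (Q.uniformized d i l)
    simp only [mul_one, uniformized_row_sum hd] at this
    exact this

lemma uniformizedPow_le_one (hl : 0 < Q.arrivalRate) (hμ : ∀ k, 0 < Q.serviceRate k)
    (hd : d ∈ Q.efficientPolicies) (s i j : ℕ) : Q.uniformizedPow d s i j ≤ 1 :=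
  le_hasSum (hasSum_uniformizedPow hd s i) j fun l _ => uniformizedPow_nonneg hl hμ hd s i l

lemma summable_expSeries {a : ℕ → ℝ} (ha : ∀ s, |a s| ≤ 1) (x : ℝ) :
    Summable fun s : ℕ => x ^ s / (s.factorial : ℝ) * a s := by
  refine Summable.of_norm_bounded (Real.summable_pow_div_factorial |x|) fun s => ?_
  rw [Real.norm_eq_abs, abs_mul, abs_div, abs_pow, Nat.abs_cast]
  exact mul_le_of_le_one_right (by positivity) (ha s)

lemma hasDerivAt_expSeries {a : ℕ → ℝ} (ha : ∀ s, |a s| ≤ 1) (x : ℝ) :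
    HasDerivAt (fun y : ℝ => ∑' s : ℕ, y ^ s / (s.factorial : ℝ) * a s)
      (∑' s : ℕ, x ^ s / (s.factorial : ℝ) * a (s + 1)) x := by
  have hterm : ∀ (s : ℕ) (y : ℝ), HasDerivAt (fun y : ℝ => y ^ s / (s.factorial : ℝ) * a s)
      ((s : ℝ) * y ^ (s - 1) / (s.factorial : ℝ) * a s) y := fun s y =>
    ((hasDerivAt_pow s y).div_const _).mul_const _
  have hstep : ∀ (s : ℕ) (y : ℝ), ((s + 1 : ℕ) : ℝ) * y ^ (s + 1 - 1) / ((s + 1).factorial : ℝ) =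
      y ^ s / (s.factorial : ℝ) := fun s y => by
    rw [Nat.factorial_succ]; push_cast
    have : (s.factorial : ℝ) ≠ 0 := by positivity
    have : (s : ℝ) + 1 ≠ 0 := by positivity
    field_simp
  have hu : Summable fun s : ℕ => (s : ℝ) * (|x| + 1) ^ (s - 1) / (s.factorial : ℝ) := by
    rw [← summable_nat_add_iff 1]
    simp_rw [hstep]
    exact Real.summable_pow_div_factorial _
  have hmain := hasDerivAt_tsum_of_isPreconnected hu Metric.isOpen_ball
    (convex_ball (0 : ℝ) (|x| + 1)).isPreconnected
    (fun s y _ => hterm s y) (fun s y hy => ?_) (Metric.mem_ball_self (by positivity))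
    (summable_expSeries ha 0) (y := x) (by simp)
  · refine hmain.congr_deriv ?_
    have hs : Summable fun s : ℕ => (s : ℝ) * x ^ (s - 1) / (s.factorial : ℝ) * a s := by
      rw [← summable_nat_add_iff 1]
      simp_rw [hstep]
      exact summable_expSeries (fun s => ha (s + 1)) x
    rw [hs.tsum_eq_zero_add]
    simp_rw [hstep]
    simp
  · have hy' : |y| ≤ |x| + 1 := by simpa using (Metric.mem_ball.1 hy).le
    rw [Real.norm_eq_abs, abs_mul, abs_div, abs_mul, abs_pow, Nat.abs_cast, Nat.abs_cast]
    refine (mul_le_of_le_one_right (by positivity) (ha s)).trans ?_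
    gcongr

lemma abs_uniformizedPow_le (hl : 0 < Q.arrivalRate) (hμ : ∀ k, 0 < Q.serviceRate k)
    (hd : d ∈ Q.efficientPolicies) (s i j : ℕ) : |Q.uniformizedPow d s i j| ≤ 1 := by
  rw [abs_of_nonneg (uniformizedPow_nonneg hl hμ hd s i j)]
  exact uniformizedPow_le_one hl hμ hd s i j

lemma transition_eq (t : ℝ) (i j : ℕ) : Q.transition d t i j = Real.exp (-(Q.uniformRate * t)) *
    ∑' s : ℕ, (Q.uniformRate * t) ^ s / (s.factorial : ℝ) * Q.uniformizedPow d s i j := by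
  rw [transition, ← tsum_mul_left]
  exact tsum_congr fun s => by ring

theorem transition_zero (i j : ℕ) : Q.transition d 0 i j = if i = j then 1 else 0 := by
  rw [transition_eq, tsum_eq_single 0]
  · simp [uniformizedPow]
  · intro s hs; simp [hs]

theorem transition_nonneg (hl : 0 < Q.arrivalRate) (hμ : ∀ k, 0 < Q.serviceRate k)
    (hd : d ∈ Q.efficientPolicies) {t : ℝ} (ht : 0 ≤ t) (i j : ℕ) : 0 ≤ Q.transition d t i j := by
  have := uniformRate_pos hl hμ
  refine tsum_nonneg fun s => mul_nonneg (by positivity) (uniformizedPow_nonneg hl hμ hd s i j)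

theorem hasSum_transition (hl : 0 < Q.arrivalRate) (hμ : ∀ k, 0 < Q.serviceRate k)
    (hd : d ∈ Q.efficientPolicies) {t : ℝ} (ht : 0 ≤ t) (i : ℕ) :
    HasSum (Q.transition d t i) 1 := by
  have hΛ := uniformRate_pos hl hμ
  set x := Q.uniformRate * t with hx
  have hx0 : 0 ≤ x := by positivity
  have h0 : HasSum (fun s : ℕ => Real.exp (-x) * x ^ s / (s.factorial : ℝ)) 1 := by
    have h := (NormedSpace.expSeries_div_hasSum_exp x).mul_left (Real.exp (-x))
    rw [← Real.exp_eq_exp_ℝ, ← Real.exp_add, neg_add_cancel, Real.exp_zero] at h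
    simpa only [mul_div_assoc] using h
  have hnn : ∀ q : ℕ × ℕ, 0 ≤ Real.exp (-x) * x ^ q.1 / (q.1.factorial : ℝ) *
      Q.uniformizedPow d q.1 i q.2 := fun q =>
    mul_nonneg (by positivity) (uniformizedPow_nonneg hl hμ hd _ _ _)
  have hrow : ∀ s : ℕ, HasSum (fun j => Real.exp (-x) * x ^ s / (s.factorial : ℝ) *
      Q.uniformizedPow d s i j) (Real.exp (-x) * x ^ s / (s.factorial : ℝ)) := fun s => by
    simpa using (hasSum_uniformizedPow hd s i).mul_left (Real.exp (-x) * x ^ s / (s.factorial : ℝ))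
  have hsum : Summable fun q : ℕ × ℕ => Real.exp (-x) * x ^ q.1 / (q.1.factorial : ℝ) *
      Q.uniformizedPow d q.1 i q.2 := by
    rw [summable_prod_of_nonneg hnn]
    refine ⟨fun s => (hrow s).summable, ?_⟩
    simp_rw [fun s => (hrow s).tsum_eq]
    exact h0.summable
  have htot := hsum.hasSum
  have hval := (htot.prod_fiberwise hrow).unique h0
  rw [hval] at htot
  have hswap := (Equiv.prodComm ℕ ℕ).hasSum_iff.2 htot
  refine hswap.prod_fiberwise fun j => ?_
  exact (hswap.summable.prod_factor j).hasSum

theorem hasDerivAt_transition (hl : 0 < Q.arrivalRate) (hμ : ∀ k, 0 < Q.serviceRate k)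
    (hd : d ∈ Q.efficientPolicies) (t : ℝ) (i j : ℕ) :
    HasDerivAt (fun t => Q.transition d t i j)
      (∑ l ∈ Finset.range (i + 2), Q.generator d i l * Q.transition d t l j) t := by
  have hΛ := (uniformRate_pos hl hμ).ne'
  have hb := fun l s => abs_uniformizedPow_le hl hμ hd s l j
  have hlin : HasDerivAt (fun t : ℝ => Q.uniformRate * t) Q.uniformRate t := by
    simpa using (hasDerivAt_id t).const_mul Q.uniformRate
  have h1 := hlin.neg.exp.mul ((hasDerivAt_expSeries (hb i) (Q.uniformRate * t)).comp t hlin)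
  have hfun : (fun t => Q.transition d t i j) = fun t => Real.exp (-(Q.uniformRate * t)) *
      ∑' s : ℕ, (Q.uniformRate * t) ^ s / (s.factorial : ℝ) * Q.uniformizedPow d s i j :=
    funext fun t => transition_eq t i j
  rw [hfun]
  refine h1.congr_deriv ?_
  have hnext : ∑' s : ℕ, (Q.uniformRate * t) ^ s / (s.factorial : ℝ) *
      Q.uniformizedPow d (s + 1) i j = ∑ l ∈ Finset.range (i + 2), Q.uniformized d i l *
        ∑' s : ℕ, (Q.uniformRate * t) ^ s / (s.factorial : ℝ) * Q.uniformizedPow d s l j := by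
    simp_rw [← tsum_mul_left]
    rw [← Summable.tsum_finsetSum fun l _ => (summable_expSeries (hb l) _).mul_left _]
    refine tsum_congr fun s => ?_
    rw [uniformizedPow, Finset.mul_sum]
    exact Finset.sum_congr rfl fun l _ => by ring
  have hgen : ∀ l, Q.generator d i l =
      Q.uniformRate * (Q.uniformized d i l - if i = l then 1 else 0) := fun l => by
    rw [uniformized]; field_simp; ring
  simp only [Function.comp_apply, Pi.neg_apply]
  rw [hnext]
  simp_rw [hgen, transition_eq, mul_sub, sub_mul, Finset.sum_sub_distrib]
  have : ∀ F : ℕ → ℝ, ∑ l ∈ Finset.range (i + 2),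
      Q.uniformRate * (if i = l then 1 else 0) * F l = Q.uniformRate * F i := fun F => by
    simp
  rw [this]
  have h2 : ∀ F : ℕ → ℝ, ∑ l ∈ Finset.range (i + 2), Q.uniformRate * Q.uniformized d i l *
      (Real.exp (-(Q.uniformRate * t)) * F l) = Real.exp (-(Q.uniformRate * t)) *
      ((∑ l ∈ Finset.range (i + 2), Q.uniformized d i l * F l) * Q.uniformRate) := fun F => by
    rw [Finset.sum_mul, Finset.mul_sum]
    exact Finset.sum_congr rfl fun l _ => by ring
  rw [h2]
  ring

end Facts

end GroupServerQueue

/-!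
Along an ultrafilter the expected occupation times converge to a solution `ν` of the detailed
balance equations; as `h` tends to infinity, a finite average cost prevents mass from escaping, so
`ν` is a stationary distribution with a finite mean cost `J`. Conversely, reversibility bounds the
transition probabilities, `p_t(i, j) ≤ ν j / ν i`, and by dominated convergence `J` is the average
cost from every `i` with `0 < ν i`. Policies are therefore compared through their stationary
distributions, and changing the action at `n` only rescales such a distribution below `n`. For an
optimal policy this yields the Bellman inequality: the action at `n` minimizes `c(m) - r(m) G(n)`,
where `c(m)` and `r(m)` are the operating cost rate and the service rate of the action `m`, and `G`
is the difference of the relative value function.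

Beyond the total number of servers all actions are available, and there `G` is strictly increasing:
otherwise it would go on to decrease at least as fast as `h` increases, whereas it is eventually
nonnegative. A server of group `k` working at `N` shows `c_k ≤ μ_k G(N)`, so `c_k < μ_k G(n)` for
all larger `n`, and no server is idle there.
-/

section PoissonMean

/-- The expectation of `a s` for a Poisson variable `s` of parameter `x`; the transition function
of a uniformized chain is such a mean of matrix powers. -/
noncomputable def poissonMean (x : ℝ) (a : ℕ → ℝ) : ℝ :=
  ∑' s : ℕ, Real.exp (-x) * x ^ s / (s.factorial : ℝ) * a s

lemma poissonMean_eq_exp_mul (x : ℝ) (a : ℕ → ℝ) :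
    poissonMean x a = Real.exp (-x) * ∑' s : ℕ, x ^ s / (s.factorial : ℝ) * a s := by
  rw [poissonMean, ← tsum_mul_left]
  exact tsum_congr fun s => by ring

lemma poissonMean_const_mul (x c : ℝ) (a : ℕ → ℝ) :
    poissonMean x (fun s => c * a s) = c * poissonMean x a := by
  simp only [poissonMean, mul_left_comm _ c, tsum_mul_left]

lemma poissonMean_sum_mul {ι : Type*} (S : Finset ι) {b : ι → ℕ → ℝ} (hb : ∀ l s, |b l s| ≤ 1)
    (c : ι → ℝ) (x : ℝ) :
    poissonMean x (fun s => ∑ l ∈ S, b l s * c l) = ∑ l ∈ S, poissonMean x (b l) * c l := by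
  simp only [poissonMean_eq_exp_mul, mul_assoc, ← Finset.mul_sum, ← tsum_mul_right]
  rw [← Summable.tsum_finsetSum fun l _ => by
    simpa only [mul_assoc] using
      (GroupServerQueue.summable_expSeries (hb l) x).mul_right (c l)]
  simp only [Finset.mul_sum]

lemma hasDerivAt_poissonMean {a : ℕ → ℝ} (ha : ∀ s, |a s| ≤ 1) (x : ℝ) :
    HasDerivAt (fun x => poissonMean x a)
      (poissonMean x (fun s => a (s + 1)) - poissonMean x a) x := by
  simp only [poissonMean_eq_exp_mul]
  refine ((hasDerivAt_neg x).exp.mul (GroupServerQueue.hasDerivAt_expSeries ha x)).congr_deriv ?_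
  ring

end PoissonMean

section TimeAverage

/-- The average of `u` over the time interval `[0, T]`; it is `0` for `T = 0`. -/
noncomputable def timeAverage (u : ℝ → ℝ) (T : ℝ) : ℝ :=
  (1 / T) * ∫ t in (0 : ℝ)..T, u t

variable {u v : ℝ → ℝ} {T : ℝ}

lemma timeAverage_const (hT : T ≠ 0) (c : ℝ) : timeAverage (fun _ => c) T = c := by
  rw [timeAverage, intervalIntegral.integral_const, smul_eq_mul, sub_zero, ← mul_assoc,
    one_div_mul_cancel hT, one_mul]

lemma timeAverage_mono_on (hT : 0 ≤ T) (hu : IntervalIntegrable u MeasureTheory.volume 0 T)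
    (hv : IntervalIntegrable v MeasureTheory.volume 0 T) (h : ∀ t ∈ Set.Icc 0 T, u t ≤ v t) :
    timeAverage u T ≤ timeAverage v T :=
  mul_le_mul_of_nonneg_left (intervalIntegral.integral_mono_on hT hu hv h) (one_div_nonneg.2 hT)

lemma timeAverage_congr (hT : 0 ≤ T) (h : ∀ t ∈ Set.Icc 0 T, u t = v t) :
    timeAverage u T = timeAverage v T := by
  rw [timeAverage, timeAverage, intervalIntegral.integral_congr fun t ht => h t ?_]
  rwa [Set.uIcc_of_le hT] at ht

lemma timeAverage_sub_const (hT : T ≠ 0) (hu : IntervalIntegrable u MeasureTheory.volume 0 T)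
    (c : ℝ) : timeAverage (fun t => u t - c) T = timeAverage u T - c := by
  conv_rhs => rw [← timeAverage_const hT c]
  rw [timeAverage, timeAverage, timeAverage,
    intervalIntegral.integral_sub hu intervalIntegrable_const, mul_sub]

lemma timeAverage_sum_mul {ι : Type*} (S : Finset ι) {u : ι → ℝ → ℝ} (hu : ∀ j, Continuous (u j))
    (c : ι → ℝ) (T : ℝ) :
    timeAverage (fun t => ∑ j ∈ S, u j t * c j) T = ∑ j ∈ S, timeAverage (u j) T * c j := by
  rw [timeAverage, intervalIntegral.integral_finsetSum fun j _ =>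
    Continuous.intervalIntegrable (u := fun t => u j t * c j) ((hu j).mul continuous_const) 0 T,
    Finset.mul_sum]
  refine Finset.sum_congr rfl fun j _ => ?_
  rw [intervalIntegral.integral_mul_const, timeAverage, mul_assoc]

end TimeAverage

lemma hasSum_of_forall_ge_eq {M : Type*} [AddCommGroup M] [TopologicalSpace M]
    [IsTopologicalAddGroup M] {g g' : ℕ → M} {A : M} {N : ℕ} (hg : HasSum g A)
    (h : ∀ n, N ≤ n → g' n = g n) :
    HasSum g' (A - ∑ n ∈ Finset.range N, g n + ∑ n ∈ Finset.range N, g' n) :=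
  (hasSum_nat_add_iff N).1 <|
    ((hasSum_nat_add_iff' N).2 hg).congr_fun fun n => h (n + N) (Nat.le_add_left N n)

section Tightness

variable {ν f : ℕ → ℝ} {η : ℝ}

lemma summable_mul_of_sum_mul_sub_le (hν : ∀ n, 0 ≤ ν n) (hν1 : ∀ N, ∑ n ∈ Finset.range N, ν n ≤ 1)
    (hf : BddBelow (Set.range f))
    (h : ∀ A N, (∀ n, N ≤ n → A ≤ f n) → ∑ n ∈ Finset.range N, ν n * (f n - A) ≤ η - A) :
    Summable fun n => ν n * f n := by
  obtain ⟨b, hb⟩ := hf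
  have hb : ∀ n, b ≤ f n := fun n => hb (Set.mem_range_self n)
  have hsum : Summable fun n => ν n * (f n - b) :=
    summable_of_sum_range_le (fun n => mul_nonneg (hν n) (sub_nonneg.2 (hb n)))
      fun N => h b N fun n _ => hb n
  refine (hsum.add ((summable_of_sum_range_le hν hν1).mul_right b)).congr fun n => ?_
  ring

/-- No mass escapes to infinity: a missing mass `δ` would contribute at least `A * δ` to the
mean of `f`, for every level `A`. -/
lemma hasSum_one_of_sum_mul_sub_le (hν : ∀ n, 0 ≤ ν n) (hν1 : ∀ N, ∑ n ∈ Finset.range N, ν n ≤ 1)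
    (hf : Tendsto f atTop atTop)
    (h : ∀ A N, (∀ n, N ≤ n → A ≤ f n) → ∑ n ∈ Finset.range N, ν n * (f n - A) ≤ η - A) :
    HasSum ν 1 := by
  obtain ⟨b, hb⟩ := bddBelow_range_of_tendsto_atTop_atTop hf
  have hb : ∀ n, b ≤ f n := fun n => hb (Set.mem_range_self n)
  have hsum : Summable ν := summable_of_sum_range_le hν hν1
  have hmissing : ∀ A, b ≤ A → (A - b) * (1 - ∑' n, ν n) ≤ η - b := fun A hA => by
    obtain ⟨N, hN⟩ := eventually_atTop.1 (hf.eventually_ge_atTop A)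
    have hbelow : 0 ≤ ∑ n ∈ Finset.range N, ν n * (f n - b) :=
      Finset.sum_nonneg fun n _ => mul_nonneg (hν n) (sub_nonneg.2 (hb n))
    have htotal := h A N hN
    calc (A - b) * (1 - ∑' n, ν n) ≤ (A - b) * (1 - ∑ n ∈ Finset.range N, ν n) :=
          mul_le_mul_of_nonneg_left (sub_le_sub_left
            (hsum.sum_le_tsum _ fun n _ => hν n) _) (sub_nonneg.2 hA)
      _ ≤ η - b := by
          simp_rw [mul_sub, Finset.sum_sub_distrib, ← Finset.sum_mul] at hbelow htotal ⊢
          linarith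
  have hmass : ∑' n, ν n = 1 := by
    refine (hsum.tsum_le_of_sum_range_le hν1).antisymm (not_lt.1 fun hlt => ?_)
    have hunbounded : Tendsto (fun A => (A - b) * (1 - ∑' n, ν n)) atTop atTop :=
      (tendsto_atTop_add_const_right _ _ tendsto_id).atTop_mul_const (sub_pos.2 hlt)
    obtain ⟨A, hA, hbA⟩ :=
      ((hunbounded.eventually_gt_atTop (η - b)).and (eventually_ge_atTop b)).exists
    exact hA.not_ge (hmissing A hbA)
  exact hmass ▸ hsum.hasSum

end Tightness

namespace GroupServerQueue

variable {K : ℕ} {Q : GroupServerQueue K} {d : ℕ → Fin K → ℕ}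

section Forward

lemma generator_eq_zero {i j : ℕ} (h : i + 1 < j ∨ j + 1 < i) : Q.generator d i j = 0 := by
  rw [generator, if_neg (by omega), if_neg (by omega), if_neg (by omega)]

lemma generator_succ (i : ℕ) : Q.generator d i (i + 1) = Q.arrivalRate :=
  if_pos rfl

lemma generator_pred (i : ℕ) : Q.generator d (i + 1) i = Q.totalRate (d (i + 1)) := by
  rw [generator, if_neg (by omega), if_pos rfl]

lemma generator_self (i : ℕ) :
    Q.generator d i i = -(Q.arrivalRate + Q.totalRate (d i)) := by
  rw [generator, if_neg (by omega), if_neg (by omega), if_pos rfl]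

lemma uniformized_eq_zero {i j : ℕ} (h : i + 1 < j ∨ j + 1 < i) : Q.uniformized d i j = 0 := by
  rw [uniformized, generator_eq_zero h, if_neg (by omega), zero_div, add_zero]

lemma uniformizedPow_one (i j : ℕ) : Q.uniformizedPow d 1 i j = Q.uniformized d i j := by
  simp only [uniformizedPow, mul_ite, mul_one, mul_zero, Finset.sum_ite_eq', Finset.mem_range,
    ite_eq_left_iff, not_lt]
  exact fun h => (uniformized_eq_zero (.inl (by omega))).symm

lemma uniformizedPow_succ_right (s i j : ℕ) :
    Q.uniformizedPow d (s + 1) i j =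
      ∑ l ∈ Finset.range (j + 2), Q.uniformizedPow d s i l * Q.uniformized d l j := by
  induction s generalizing i with
  | zero =>
    rw [zero_add, uniformizedPow_one]
    simp only [uniformizedPow, ite_mul, one_mul, zero_mul, Finset.sum_ite_eq, Finset.mem_range]
    split_ifs with h
    · rfl
    · exact uniformized_eq_zero (.inr (by omega))
  | succ s ih =>
    rw [uniformizedPow]
    simp_rw [ih, Finset.mul_sum]
    rw [Finset.sum_comm]
    refine Finset.sum_congr rfl fun m _ => ?_
    rw [uniformizedPow, Finset.sum_mul]
    exact Finset.sum_congr rfl fun l _ => (mul_assoc _ _ _).symm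

lemma sum_sum_mul_generator (hd : d ∈ Q.efficientPolicies) (x : ℕ → ℝ) (n : ℕ) :
    ∑ j ∈ Finset.range (n + 1), ∑ l ∈ Finset.range (j + 2), x l * Q.generator d l j =
      Q.totalRate (d (n + 1)) * x (n + 1) - Q.arrivalRate * x n := by
  induction n with
  | zero =>
    simp only [Finset.sum_range_succ, Finset.range_zero, Finset.sum_empty, zero_add,
      generator_self, totalRate_zero hd]
    rw [generator_pred 0]
    ring
  | succ n ih =>
    have hfar : ∑ l ∈ Finset.range n, x l * Q.generator d l (n + 1) = 0 :=
      Finset.sum_eq_zero fun l hl => by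
        rw [generator_eq_zero (.inl (Nat.succ_lt_succ (Finset.mem_range.1 hl))), mul_zero]
    rw [Finset.sum_range_succ, ih, Finset.sum_range_succ, Finset.sum_range_succ,
      Finset.sum_range_succ, hfar, generator_pred, generator_self, generator_succ]
    ring

variable (hl : 0 < Q.arrivalRate) (hμ : ∀ k, 0 < Q.serviceRate k) (hd : d ∈ Q.efficientPolicies)
include hl hμ hd

theorem hasDerivAt_transition_forward (t : ℝ) (i j : ℕ) :
    HasDerivAt (fun t => Q.transition d t i j)
      (∑ l ∈ Finset.range (j + 2), Q.transition d t i l * Q.generator d l j) t := by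
  have hb : ∀ l s, |Q.uniformizedPow d s i l| ≤ 1 := fun l s => abs_uniformizedPow_le hl hμ hd s i l
  have hscale : HasDerivAt (fun t => Q.uniformRate * t) Q.uniformRate t := by
    simpa using (hasDerivAt_id t).const_mul Q.uniformRate
  have hderiv := (hasDerivAt_poissonMean (hb j) (Q.uniformRate * t)).comp t hscale
  have hshift : poissonMean (Q.uniformRate * t) (fun s => Q.uniformizedPow d (s + 1) i j) =
      ∑ l ∈ Finset.range (j + 2), Q.transition d t i l * Q.uniformized d l j := by
    simp_rw [uniformizedPow_succ_right]
    exact poissonMean_sum_mul _ hb _ _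
  have hgen : ∀ l, Q.generator d l j =
      (Q.uniformized d l j - if l = j then 1 else 0) * Q.uniformRate := fun l => by
    rw [uniformized, add_sub_cancel_left, div_mul_cancel₀ _ (uniformRate_pos hl hμ).ne']
  refine hderiv.congr_deriv ?_
  rw [hshift]
  simp_rw [hgen, ← mul_assoc, ← Finset.sum_mul, mul_sub, Finset.sum_sub_distrib, mul_ite, mul_one,
    mul_zero]
  rw [Finset.sum_ite_eq', if_pos (Finset.mem_range.2 (by omega))]
  rfl

lemma hasDerivAt_sum_transition (t : ℝ) (i n : ℕ) :
    HasDerivAt (fun t => ∑ j ∈ Finset.range (n + 1), Q.transition d t i j)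
      (Q.totalRate (d (n + 1)) * Q.transition d t i (n + 1) -
        Q.arrivalRate * Q.transition d t i n) t := by
  rw [← sum_sum_mul_generator hd]
  exact HasDerivAt.fun_sum fun j _ => hasDerivAt_transition_forward hl hμ hd t i j

lemma continuous_transition (i j : ℕ) : Continuous fun t => Q.transition d t i j :=
  continuous_iff_continuousAt.2 fun t =>
    (hasDerivAt_transition_forward hl hμ hd t i j).continuousAt

lemma sum_transition_le_one {t : ℝ} (ht : 0 ≤ t) (i : ℕ) (S : Finset ℕ) :
    ∑ j ∈ S, Q.transition d t i j ≤ 1 :=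
  sum_le_hasSum S (fun j _ => transition_nonneg hl hμ hd ht i j) (hasSum_transition hl hμ hd ht i)

lemma transition_le_one {t : ℝ} (ht : 0 ≤ t) (i j : ℕ) : Q.transition d t i j ≤ 1 := by
  simpa only [Finset.sum_singleton] using sum_transition_le_one hl hμ hd ht i {j}

end Forward

section Occupation

/-- Expected fraction of the time interval `[0, T]` spent in state `j`, starting from `i`. -/
noncomputable def occupation (Q : GroupServerQueue K) (d : ℕ → Fin K → ℕ) (T : ℝ) (i j : ℕ) : ℝ :=
  timeAverage (fun t => Q.transition d t i j) T

/-- The detailed balance equations of the birth-death process under `d`: the flow up from `n`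
equals the flow down from `n + 1`. -/
def DetailedBalance (Q : GroupServerQueue K) (d : ℕ → Fin K → ℕ) (ν : ℕ → ℝ) : Prop :=
  ∀ n, Q.totalRate (d (n + 1)) * ν (n + 1) = Q.arrivalRate * ν n

variable (hl : 0 < Q.arrivalRate) (hμ : ∀ k, 0 < Q.serviceRate k) (hd : d ∈ Q.efficientPolicies)
include hl hμ hd

lemma intervalIntegrable_transition (a b : ℝ) (i j : ℕ) :
    IntervalIntegrable (fun t => Q.transition d t i j) MeasureTheory.volume a b :=
  (continuous_transition hl hμ hd i j).intervalIntegrable a b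

lemma sum_occupation_mul (T : ℝ) (i : ℕ) (S : Finset ℕ) (g : ℕ → ℝ) :
    ∑ j ∈ S, Q.occupation d T i j * g j =
      timeAverage (fun t => ∑ j ∈ S, Q.transition d t i j * g j) T :=
  (timeAverage_sum_mul S (continuous_transition hl hμ hd i) g T).symm

variable {T : ℝ} (hT : 0 < T)
include hT

lemma occupation_le_of_transition_le {i j : ℕ} {c : ℝ}
    (h : ∀ t, 0 ≤ t → Q.transition d t i j ≤ c) : Q.occupation d T i j ≤ c :=
  (timeAverage_mono_on hT.le (intervalIntegrable_transition hl hμ hd 0 T i j)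
    intervalIntegrable_const fun t ht => h t ht.1).trans_eq (timeAverage_const hT.ne' c)

lemma occupation_nonneg (i j : ℕ) : 0 ≤ Q.occupation d T i j :=
  mul_nonneg (by positivity) (intervalIntegral.integral_nonneg hT.le fun t ht =>
    transition_nonneg hl hμ hd ht.1 i j)

lemma sum_occupation_le_one (i : ℕ) (S : Finset ℕ) : ∑ j ∈ S, Q.occupation d T i j ≤ 1 := by
  have hmean := sum_occupation_mul hl hμ hd T i S fun _ => 1
  simp only [mul_one] at hmean
  rw [hmean, ← timeAverage_const hT.ne' 1]
  exact timeAverage_mono_on hT.le ((continuous_finsetSum _ fun j _ =>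
    continuous_transition hl hμ hd i j).intervalIntegrable _ _) intervalIntegrable_const
    fun t ht => sum_transition_le_one hl hμ hd ht.1 i S

lemma occupation_mem_Icc (i j : ℕ) : Q.occupation d T i j ∈ Set.Icc 0 1 :=
  ⟨occupation_nonneg hl hμ hd hT i j,
    occupation_le_of_transition_le hl hμ hd hT fun _ ht => transition_le_one hl hμ hd ht i j⟩

omit hT

lemma occupation_flux (T : ℝ) (i n : ℕ) :
    Q.totalRate (d (n + 1)) * Q.occupation d T i (n + 1) - Q.arrivalRate * Q.occupation d T i n =
      (1 / T) * (∑ j ∈ Finset.range (n + 1), Q.transition d T i j -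
        ∑ j ∈ Finset.range (n + 1), Q.transition d 0 i j) := by
  have hint : ∀ c j, IntervalIntegrable (fun t => c * Q.transition d t i j)
      MeasureTheory.volume 0 T := fun c j =>
    (intervalIntegrable_transition hl hμ hd 0 T i j).const_mul c
  rw [← intervalIntegral.integral_eq_sub_of_hasDerivAt
    (fun t _ => hasDerivAt_sum_transition hl hμ hd t i n) ((hint _ _).sub (hint _ _)),
    intervalIntegral.integral_sub (hint _ _) (hint _ _), intervalIntegral.integral_const_mul,
    intervalIntegral.integral_const_mul, occupation, occupation, timeAverage, timeAverage]
  ring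

lemma tendsto_occupation_flux (i n : ℕ) :
    Tendsto (fun T => Q.totalRate (d (n + 1)) * Q.occupation d T i (n + 1) -
      Q.arrivalRate * Q.occupation d T i n) atTop (𝓝 0) := by
  refine squeeze_zero_norm' (a := fun T : ℝ => 1 / T) ?_
    (tendsto_const_nhds.div_atTop tendsto_id)
  filter_upwards [eventually_gt_atTop 0] with T hT
  have hmass : ∀ t, 0 ≤ t → ∑ j ∈ Finset.range (n + 1), Q.transition d t i j ∈ Set.Icc 0 1 :=
    fun t ht => ⟨Finset.sum_nonneg fun j _ => transition_nonneg hl hμ hd ht i j,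
      sum_transition_le_one hl hμ hd ht i _⟩
  rw [occupation_flux hl hμ hd, norm_mul, Real.norm_of_nonneg (by positivity : 0 ≤ 1 / T)]
  exact mul_le_of_le_one_right (by positivity) (abs_sub_le_of_nonneg_of_le (hmass T hT.le).1
    (hmass T hT.le).2 (hmass 0 le_rfl).1 (hmass 0 le_rfl).2)

lemma exists_tendsto_occupation (i : ℕ) (F : Ultrafilter ℝ) (hF : (F : Filter ℝ) ≤ atTop) :
    ∃ ν : ℕ → ℝ, (∀ n, Tendsto (fun T => Q.occupation d T i n) F (𝓝 (ν n))) ∧ (∀ n, 0 ≤ ν n) ∧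
      Q.DetailedBalance d ν := by
  have hpos : ∀ᶠ T in (F : Filter ℝ), 0 < T := hF (eventually_gt_atTop 0)
  have hlim : ∀ n, ∃ x ∈ Set.Icc (0 : ℝ) 1,
      Tendsto (fun T => Q.occupation d T i n) F (𝓝 x) := fun n =>
    isCompact_Icc.ultrafilter_le_nhds (F.map fun T => Q.occupation d T i n) <|
      tendsto_principal.2 <| hpos.mono fun T hT => occupation_mem_Icc hl hμ hd hT i n
  choose ν hν hlim using hlim
  refine ⟨ν, hlim, fun n => (hν n).1, fun n => sub_eq_zero.1 ?_⟩
  exact tendsto_nhds_unique (((hlim (n + 1)).const_mul _).sub ((hlim n).const_mul _))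
    ((tendsto_occupation_flux hl hμ hd i n).mono_left hF)

end Occupation

section Reversible

variable {ν π : ℕ → ℝ}

lemma DetailedBalance.mul_generator_symm (hν : Q.DetailedBalance d ν) (i j : ℕ) :
    ν i * Q.generator d i j = ν j * Q.generator d j i := by
  wlog hij : i ≤ j generalizing i j
  · exact (this j i (le_of_not_ge hij)).symm
  obtain rfl | rfl | hij : i = j ∨ j = i + 1 ∨ i + 1 < j := by omega
  · rfl
  · rw [generator_succ, generator_pred, mul_comm, ← hν, mul_comm]
  · rw [generator_eq_zero (.inl hij), generator_eq_zero (.inr hij), mul_zero, mul_zero]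

lemma DetailedBalance.mul_uniformized_symm (hν : Q.DetailedBalance d ν) (i j : ℕ) :
    ν i * Q.uniformized d i j = ν j * Q.uniformized d j i := by
  obtain rfl | hij := eq_or_ne i j
  · rfl
  · rw [uniformized, uniformized, if_neg hij, if_neg hij.symm, zero_add, zero_add,
      ← mul_div_assoc, hν.mul_generator_symm, mul_div_assoc]

lemma DetailedBalance.mul_uniformizedPow_symm (hν : Q.DetailedBalance d ν) (s i j : ℕ) :
    ν i * Q.uniformizedPow d s i j = ν j * Q.uniformizedPow d s j i := by
  induction s generalizing i with
  | zero =>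
    obtain rfl | hij := eq_or_ne i j
    · rfl
    · simp only [uniformizedPow, if_neg hij, if_neg hij.symm, mul_zero]
  | succ s ih =>
    rw [uniformizedPow_succ_right s j i, uniformizedPow, Finset.mul_sum, Finset.mul_sum]
    refine Finset.sum_congr rfl fun l _ => ?_
    rw [← mul_assoc, hν.mul_uniformized_symm, mul_right_comm, ih, mul_assoc]

lemma DetailedBalance.mul_transition_symm (hν : Q.DetailedBalance d ν) (t : ℝ) (i j : ℕ) :
    ν i * Q.transition d t i j = ν j * Q.transition d t j i :=
  calc ν i * Q.transition d t i j
      = poissonMean (Q.uniformRate * t) fun s => ν i * Q.uniformizedPow d s i j :=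
        (poissonMean_const_mul _ _ _).symm
    _ = poissonMean (Q.uniformRate * t) fun s => ν j * Q.uniformizedPow d s j i :=
        congrArg _ <| funext fun s => hν.mul_uniformizedPow_symm s i j
    _ = ν j * Q.transition d t j i := poissonMean_const_mul _ _ _

lemma DetailedBalance.pos (hl : 0 < Q.arrivalRate) (hν : Q.DetailedBalance d ν)
    (hν₀ : ∀ n, 0 ≤ ν n) {i n : ℕ} (hin : i ≤ n) (hi : 0 < ν i) : 0 < ν n := by
  induction n, hin using Nat.le_induction with
  | base => exact hi
  | succ n _ ih =>
    refine (hν₀ _).lt_of_ne' fun h => (mul_pos hl ih).ne ?_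
    rw [← hν, h, mul_zero]

lemma DetailedBalance.mul_eq_mul (hl : 0 < Q.arrivalRate) (hν : Q.DetailedBalance d ν)
    (hπ : Q.DetailedBalance d π) (hν₀ : ∀ n, 0 ≤ ν n) (hac : ∀ n, ν n = 0 → π n = 0)
    {i : ℕ} (hi : 0 < ν i) (n : ℕ) : π n * ν i = π i * ν n := by
  have hcross : ∀ n, π n * ν (n + 1) = π (n + 1) * ν n := fun n =>
    mul_left_cancel₀ hl.ne' (by linear_combination π (n + 1) * hν n - ν (n + 1) * hπ n)
  rcases le_total i n with hin | hni
  · induction n, hin using Nat.le_induction with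
    | base => rfl
    | succ n hn ih =>
      refine mul_left_cancel₀ (hν.pos hl hν₀ hn hi).ne' ?_
      linear_combination ν (n + 1) * ih - ν i * hcross n
  · induction hni using Nat.decreasingInduction with
    | self => rfl
    | of_succ n _ ih =>
      rcases (hν₀ n).eq_or_lt' with hzero | hpos
      · rw [hzero, hac n hzero, zero_mul, mul_zero]
      · refine mul_left_cancel₀ (hν.pos hl hν₀ (Nat.le_succ n) hpos).ne' ?_
        linear_combination ν n * ih + ν i * hcross n

/-- `ν` is a stationary distribution of the number of customers under `d`; being that of a
birth-death process, it is reversible, and stationarity is encoded by detailed balance. -/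
structure IsStationary (Q : GroupServerQueue K) (d : ℕ → Fin K → ℕ) (ν : ℕ → ℝ) : Prop where
  nonneg : ∀ n, 0 ≤ ν n
  balance : Q.DetailedBalance d ν
  hasSum_one : HasSum ν 1

lemma IsStationary.exists_pos (hν : Q.IsStationary d ν) : ∃ n, 0 < ν n := by
  by_contra! hle
  have hzero : ν = 0 := funext fun n => (hle n).antisymm (hν.nonneg n)
  exact zero_ne_one (hasSum_zero.unique (hzero ▸ hν.hasSum_one))

lemma IsStationary.eq_of_forall_eq_zero (hl : 0 < Q.arrivalRate) (hν : Q.IsStationary d ν)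
    (hπ : Q.IsStationary d π) (hac : ∀ n, ν n = 0 → π n = 0) : π = ν := by
  obtain ⟨i, hi⟩ := hν.exists_pos
  have hprop : ∀ n, π n * ν i = π i * ν n := hν.balance.mul_eq_mul hl hπ.balance hν.nonneg hac hi
  have hfactor : ν i = π i := by
    have hsum := hπ.hasSum_one.mul_right (ν i)
    simp_rw [hprop] at hsum
    simpa only [one_mul, mul_one] using hsum.unique (hν.hasSum_one.mul_left (π i))
  exact funext fun n => mul_right_cancel₀ hi.ne' (by rw [hprop, ← hfactor, mul_comm])

variable (hl : 0 < Q.arrivalRate) (hμ : ∀ k, 0 < Q.serviceRate k) (hd : d ∈ Q.efficientPolicies)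
include hl hμ hd

lemma DetailedBalance.transition_le_div (hν : Q.DetailedBalance d ν) {t : ℝ} (ht : 0 ≤ t)
    {i j : ℕ} (hi : 0 < ν i) (hj : 0 ≤ ν j) : Q.transition d t i j ≤ ν j / ν i := by
  rw [le_div_iff₀' hi, hν.mul_transition_symm]
  exact mul_le_of_le_one_right hj (transition_le_one hl hμ hd ht j i)

end Reversible

section Existence

/-- `ν` is a stationary distribution under `d`, and the stationary mean of the cost rate is the
finite number `J`. -/
structure HasStationaryCost (Q : GroupServerQueue K) (d : ℕ → Fin K → ℕ) (ν : ℕ → ℝ) (J : ℝ) : Prop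
    extends Q.IsStationary d ν where
  hasSum_cost : HasSum (fun n => ν n * Q.costRate n (d n)) J

lemma tendsto_costRate (hd : d ∈ Q.efficientPolicies)
    (hinf : Tendsto Q.holdingCost atTop atTop) :
    Tendsto (fun n => Q.costRate n (d n)) atTop atTop := by
  refine tendsto_atTop_add_right_of_le _ (-∑ k, (Q.servers k : ℝ) * |Q.operatingCost k|) hinf
    fun n => ?_
  rw [← Finset.sum_neg_distrib]
  refine Finset.sum_le_sum fun k _ => neg_le_of_abs_le ?_
  rw [abs_mul, Nat.abs_cast]
  exact mul_le_mul_of_nonneg_right (Nat.cast_le.2 ((hd n).1 k)) (abs_nonneg _)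

variable (hl : 0 < Q.arrivalRate) (hμ : ∀ k, 0 < Q.serviceRate k) (hd : d ∈ Q.efficientPolicies)
include hl hμ hd

lemma sum_transition_mul_sub_le {t : ℝ} (ht : 0 ≤ t) {i : ℕ}
    (hs : Summable fun n => Q.transition d t i n * Q.costRate n (d n)) {A : ℝ} {N : ℕ}
    (hA : ∀ n, N ≤ n → A ≤ Q.costRate n (d n)) :
    ∑ n ∈ Finset.range N, Q.transition d t i n * (Q.costRate n (d n) - A) ≤
      Q.expectedCostRate d i t - A := by
  have hsum := hs.hasSum.sub ((hasSum_transition hl hμ hd ht i).mul_right A)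
  simp_rw [one_mul, ← mul_sub] at hsum
  refine sum_le_hasSum _ (fun n hn => ?_) hsum
  exact mul_nonneg (transition_nonneg hl hμ hd ht i n)
    (sub_nonneg.2 (hA n (not_lt.1 fun hlt => hn (Finset.mem_range.2 hlt))))

lemma HasAverageCost.sum_occupation_mul_sub_le {i : ℕ} {η : ℝ} (hη : Q.HasAverageCost d i η)
    {T : ℝ} (hT : 0 < T) {A : ℝ} {N : ℕ} (hA : ∀ n, N ≤ n → A ≤ Q.costRate n (d n)) :
    ∑ n ∈ Finset.range N, Q.occupation d T i n * (Q.costRate n (d n) - A) ≤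
      timeAverage (Q.expectedCostRate d i) T - A := by
  have hcost := hη.2.1 T hT
  rw [sum_occupation_mul hl hμ hd, ← timeAverage_sub_const hT.ne' hcost]
  refine timeAverage_mono_on hT.le (Continuous.intervalIntegrable ?_ _ _)
    (hcost.sub intervalIntegrable_const)
    fun t ht => sum_transition_mul_sub_le hl hμ hd ht.1 (hη.1 t ht.1) hA
  exact continuous_finsetSum _ fun n _ =>
    (continuous_transition hl hμ hd i n).mul continuous_const

theorem HasAverageCost.exists_hasStationaryCost (hinf : Tendsto Q.holdingCost atTop atTop) {i : ℕ}
    {η : ℝ} (hη : Q.HasAverageCost d i η) : ∃ ν J, Q.HasStationaryCost d ν J := by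
  obtain ⟨F, hF⟩ : ∃ F : Ultrafilter ℝ, (F : Filter ℝ) ≤ atTop := ⟨_, Ultrafilter.of_le atTop⟩
  have hpos : ∀ᶠ T in (F : Filter ℝ), 0 < T := hF (eventually_gt_atTop 0)
  obtain ⟨ν, hlim, hν₀, hbal⟩ := exists_tendsto_occupation hl hμ hd i F hF
  have hmass : ∀ N, ∑ n ∈ Finset.range N, ν n ≤ 1 := fun N =>
    le_of_tendsto (tendsto_finsetSum _ fun n _ => hlim n)
      (hpos.mono fun T hT => sum_occupation_le_one hl hμ hd hT i _)
  have hcost : ∀ A N, (∀ n, N ≤ n → A ≤ Q.costRate n (d n)) →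
      ∑ n ∈ Finset.range N, ν n * (Q.costRate n (d n) - A) ≤ η - A := fun A N hA =>
    le_of_tendsto_of_tendsto (tendsto_finsetSum _ fun n _ => (hlim n).mul_const _)
      ((hη.2.2.mono_left hF).sub_const A)
      (hpos.mono fun T hT => hη.sum_occupation_mul_sub_le hl hμ hd hT hA)
  have htend := tendsto_costRate hd hinf
  exact ⟨ν, _, ⟨hν₀, hbal, hasSum_one_of_sum_mul_sub_le hν₀ hmass htend hcost⟩,
    (summable_mul_of_sum_mul_sub_le hν₀ hmass
      (bddBelow_range_of_tendsto_atTop_atTop htend) hcost).hasSum⟩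

end Existence

section Ergodic

variable {ν : ℕ → ℝ} (hl : 0 < Q.arrivalRate) (hμ : ∀ k, 0 < Q.serviceRate k)
  (hd : d ∈ Q.efficientPolicies) (hν : Q.IsStationary d ν) {i : ℕ} (hi : 0 < ν i)
include hl hμ hd hν hi

lemma norm_transition_mul_le {t : ℝ} (ht : 0 ≤ t) (n : ℕ) (x : ℝ) :
    ‖Q.transition d t i n * x‖ ≤ ‖ν n * x‖ / ν i := by
  rw [norm_mul, norm_mul, mul_div_right_comm, Real.norm_of_nonneg (hν.nonneg n),
    Real.norm_of_nonneg (transition_nonneg hl hμ hd ht i n)]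
  exact mul_le_mul_of_nonneg_right
    (hν.balance.transition_le_div hl hμ hd ht hi (hν.nonneg n)) (norm_nonneg _)

lemma occupation_le_div {T : ℝ} (hT : 0 < T) (n : ℕ) : Q.occupation d T i n ≤ ν n / ν i :=
  occupation_le_of_transition_le hl hμ hd hT fun _ ht =>
    hν.balance.transition_le_div hl hμ hd ht hi (hν.nonneg n)

lemma norm_occupation_mul_le {T : ℝ} (hT : 0 < T) (n : ℕ) (x : ℝ) :
    ‖Q.occupation d T i n * x‖ ≤ ‖ν n * x‖ / ν i := by
  rw [norm_mul, norm_mul, mul_div_right_comm, Real.norm_of_nonneg (hν.nonneg n),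
    Real.norm_of_nonneg (occupation_nonneg hl hμ hd hT i n)]
  exact mul_le_mul_of_nonneg_right (occupation_le_div hl hμ hd hν hi hT n) (norm_nonneg _)

lemma summable_transition_mul {g : ℕ → ℝ} (hg : Summable fun n => ν n * g n) {t : ℝ}
    (ht : 0 ≤ t) : Summable fun n => Q.transition d t i n * g n :=
  Summable.of_norm_bounded (hg.norm.div_const (ν i)) fun n =>
    norm_transition_mul_le hl hμ hd hν hi ht n (g n)

lemma intervalIntegrable_tsum_transition_mul {g : ℕ → ℝ} (hg : Summable fun n => ν n * g n) {T : ℝ}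
    (hT : 0 ≤ T) :
    IntervalIntegrable (fun t => ∑' n, Q.transition d t i n * g n) MeasureTheory.volume 0 T :=
  ContinuousOn.intervalIntegrable_of_Icc hT <| continuousOn_tsum
    (fun n => ((continuous_transition hl hμ hd i n).mul continuous_const).continuousOn)
    (hg.norm.div_const (ν i)) fun n _ ht => norm_transition_mul_le hl hμ hd hν hi ht.1 n (g n)

lemma hasSum_occupation_mul {g : ℕ → ℝ} (hg : Summable fun n => ν n * g n) {T : ℝ} (hT : 0 < T) :
    HasSum (fun n => Q.occupation d T i n * g n)
      (timeAverage (fun t => ∑' n, Q.transition d t i n * g n) T) := by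
  have hnonneg : ∀ t ∈ Set.uIoc 0 T, 0 ≤ t := fun t ht => by
    rw [Set.uIoc_of_le hT.le] at ht
    exact ht.1.le
  have hsum := intervalIntegral.hasSum_integral_of_dominated_convergence
    (μ := MeasureTheory.volume) (a := 0) (b := T)
    (F := fun n t => Q.transition d t i n * g n) (f := fun t => ∑' n, Q.transition d t i n * g n)
    (fun n _ => ‖ν n * g n‖ / ν i)
    (fun n => ((continuous_transition hl hμ hd i n).mul continuous_const).aestronglyMeasurable)
    (fun n => .of_forall fun t ht =>
      norm_transition_mul_le hl hμ hd hν hi (hnonneg t ht) n (g n))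
    (.of_forall fun _ _ => hg.norm.div_const (ν i)) intervalIntegrable_const
    (.of_forall fun t ht => (summable_transition_mul hl hμ hd hν hi hg (hnonneg t ht)).hasSum)
  refine (hsum.mul_left (1 / T)).congr_fun fun n => ?_
  rw [intervalIntegral.integral_mul_const, occupation, timeAverage, mul_assoc]

lemma hasSum_occupation {T : ℝ} (hT : 0 < T) : HasSum (Q.occupation d T i) 1 := by
  have hsum := hasSum_occupation_mul hl hμ hd hν hi (g := fun _ => 1)
    (hν.hasSum_one.summable.mul_right 1) hT
  have hmass : timeAverage (fun t => ∑' n, Q.transition d t i n * 1) T = 1 :=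
    (timeAverage_congr hT.le fun t ht => by
      simpa only [mul_one] using (hasSum_transition hl hμ hd ht.1 i).tsum_eq).trans
      (timeAverage_const hT.ne' 1)
  rw [hmass] at hsum
  simpa only [mul_one] using hsum

lemma tendsto_occupation (n : ℕ) : Tendsto (fun T => Q.occupation d T i n) atTop (𝓝 (ν n)) := by
  refine (tendsto_iff_ultrafilter _ _ _).2 fun F hF => ?_
  have hpos : ∀ᶠ T in (F : Filter ℝ), 0 < T := hF (eventually_gt_atTop 0)
  obtain ⟨π, hπ, hπ₀, hbal⟩ := exists_tendsto_occupation hl hμ hd i F hF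
  have hle : ∀ n, π n ≤ ν n / ν i := fun n =>
    le_of_tendsto (hπ n) (hpos.mono fun T hT => occupation_le_div hl hμ hd hν hi hT n)
  have hdom : Summable fun n => ν n / ν i := hν.hasSum_one.summable.div_const _
  have hmass : ∑' n, π n = 1 := by
    refine tendsto_nhds_unique (tendsto_tsum_of_dominated_convergence hdom hπ
      (hpos.mono fun T hT n => ?_)) (tendsto_const_nhds.congr' (hpos.mono fun T hT =>
        (hasSum_occupation hl hμ hd hν hi hT).tsum_eq.symm))
    rw [Real.norm_of_nonneg (occupation_nonneg hl hμ hd hT i n)]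
    exact occupation_le_div hl hμ hd hν hi hT n
  have hstat : Q.IsStationary d π :=
    ⟨hπ₀, hbal, hmass ▸ (Summable.of_nonneg_of_le hπ₀ hle hdom).hasSum⟩
  have hac : ∀ n, ν n = 0 → π n = 0 := fun n hn =>
    ((hle n).trans_eq (by rw [hn, zero_div])).antisymm (hπ₀ n)
  exact hν.eq_of_forall_eq_zero hl hstat hac ▸ hπ n

omit hν in
theorem HasStationaryCost.hasAverageCost {J : ℝ} (hJ : Q.HasStationaryCost d ν J) :
    Q.HasAverageCost d i J := by
  have hν := hJ.toIsStationary
  have hs := hJ.hasSum_cost.summable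
  refine ⟨fun t ht => summable_transition_mul hl hμ hd hν hi hs ht,
    fun T hT => intervalIntegrable_tsum_transition_mul hl hμ hd hν hi hs hT.le, ?_⟩
  rw [← hJ.hasSum_cost.tsum_eq]
  refine (tendsto_tsum_of_dominated_convergence (hs.norm.div_const (ν i))
    (fun n => (tendsto_occupation hl hμ hd hν hi n).mul_const _)
    ((eventually_gt_atTop 0).mono fun T hT n =>
      norm_occupation_mul_le hl hμ hd hν hi hT n _)).congr' ?_
  filter_upwards [eventually_gt_atTop 0] with T hT
  exact (hasSum_occupation_mul hl hμ hd hν hi hs hT).tsum_eq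

end Ergodic

section Competitors

variable {ν π : ℕ → ℝ} {J : ℝ} (hl : 0 < Q.arrivalRate) (hμ : ∀ k, 0 < Q.serviceRate k)

lemma DetailedBalance.hasStationaryCost_normalize (hπ : Q.DetailedBalance d π)
    (hπ₀ : ∀ n, 0 ≤ π n) {S C : ℝ} (hS : HasSum π S) (hS₀ : S ≠ 0)
    (hC : HasSum (fun n => π n * Q.costRate n (d n)) C) :
    Q.HasStationaryCost d (fun n => S⁻¹ * π n) (S⁻¹ * C) where
  nonneg n := mul_nonneg (inv_nonneg.2 (hS.nonneg hπ₀)) (hπ₀ n)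
  balance n := by rw [mul_left_comm, hπ, mul_left_comm]
  hasSum_one := by simpa only [inv_mul_cancel₀ hS₀] using hS.mul_left S⁻¹
  hasSum_cost := by simpa only [mul_assoc] using hC.mul_left S⁻¹

include hl hμ

lemma IsOptimal.le_of_hasStationaryCost (hopt : Q.IsOptimal d) (hJ : Q.HasStationaryCost d ν J)
    {d' : ℕ → Fin K → ℕ} (hd' : d' ∈ Q.efficientPolicies) {J' : ℝ}
    (hJ' : Q.HasStationaryCost d' π J') {i : ℕ} (hi : 0 < ν i) (hi' : 0 < π i) : J ≤ J' := by
  obtain ⟨η, hη, hmin⟩ := hopt.2 i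
  have hηJ : η = J :=
    tendsto_nhds_unique hη.2.2 (hJ.hasAverageCost hl hμ hopt.1 hi).2.2
  exact hηJ ▸ hmin d' hd' J' (hJ'.hasAverageCost hl hμ hd' hi')

/-- The tails of the two mean costs cancel, which leaves a comparison over finitely many states. -/
theorem IsOptimal.sum_excess_le (hopt : Q.IsOptimal d) (hJ : Q.HasStationaryCost d ν J)
    {d' : ℕ → Fin K → ℕ} (hd' : d' ∈ Q.efficientPolicies) (hπ : Q.DetailedBalance d' π)
    (hπ₀ : ∀ n, 0 ≤ π n) {N : ℕ} (hdN : ∀ n, N ≤ n → d' n = d n) {a : ℝ} (ha : 0 < a)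
    (hπN : ∀ n, N ≤ n → π n = a * ν n) :
    ∑ j ∈ Finset.range N, a * (ν j * (Q.costRate j (d j) - J)) ≤
      ∑ j ∈ Finset.range N, π j * (Q.costRate j (d' j) - J) := by
  have hmass := hasSum_of_forall_ge_eq (hJ.hasSum_one.mul_left a) hπN
  have hcost := hasSum_of_forall_ge_eq (hJ.hasSum_cost.mul_left a)
    (g' := fun n => π n * Q.costRate n (d' n))
    fun n hn => by rw [hπN n hn, hdN n hn, mul_assoc]
  obtain ⟨i, hNi, hi⟩ : ∃ i, N ≤ i ∧ 0 < ν i := by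
    obtain ⟨i, hi⟩ := hJ.exists_pos
    exact ⟨max N i, le_max_left .., hJ.balance.pos hl hJ.nonneg (le_max_right ..) hi⟩
  have hi' : 0 < π i := hπN i hNi ▸ mul_pos ha hi
  have hS := hi'.trans_le (le_hasSum hmass i fun n _ => hπ₀ n)
  have hle := hopt.le_of_hasStationaryCost hl hμ hJ hd'
    (hπ.hasStationaryCost_normalize hπ₀ hmass hS.ne' hcost) hi (mul_pos (inv_pos.2 hS) hi')
  rw [inv_mul_eq_div, le_div_iff₀ hS] at hle
  simp_rw [mul_sub, Finset.sum_sub_distrib, ← mul_assoc, ← Finset.sum_mul, mul_assoc] at hle ⊢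
  linarith

end Competitors

section Actions

/-- The actions available to an efficient policy at state `n`. -/
def actions (Q : GroupServerQueue K) (n : ℕ) : Set (Fin K → ℕ) :=
  {m | (∀ k, m k ≤ Q.servers k) ∧ ∑ k, m k ≤ n}

variable {n : ℕ} {m m' : Fin K → ℕ}

lemma update_mem_efficientPolicies (hd : d ∈ Q.efficientPolicies) (hm : m ∈ Q.actions n) :
    Function.update d n m ∈ Q.efficientPolicies :=
  (Function.forall_update_iff d fun n m => m ∈ Q.actions n).2 ⟨hm, fun j _ => hd j⟩

lemma zero_mem_actions (n : ℕ) : 0 ∈ Q.actions n :=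
  ⟨fun _ => Nat.zero_le _, by simp only [Pi.zero_apply, Finset.sum_const_zero, Nat.zero_le]⟩

lemma eq_zero_of_mem_actions_zero (hm : m ∈ Q.actions 0) : m = 0 :=
  funext fun k => Finset.sum_eq_zero_iff.1 (Nat.eq_zero_of_le_zero hm.2) k (Finset.mem_univ k)

lemma mem_actions_of_le (hm : m ∈ Q.actions n) (hle : m' ≤ m) : m' ∈ Q.actions n :=
  ⟨fun k => (hle k).trans (hm.1 k), (Finset.sum_le_sum fun k _ => hle k).trans hm.2⟩

lemma add_single_mem_actions (hm : m ∈ Q.actions n) {k : Fin K} (hk : m k < Q.servers k)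
    (hn : ∑ k, m k < n) : m + Pi.single k 1 ∈ Q.actions n := by
  refine ⟨fun j => ?_, ?_⟩
  · obtain rfl | hj := eq_or_ne j k
    · simpa only [Pi.add_apply, Pi.single_eq_same] using Nat.succ_le_of_lt hk
    · simpa only [Pi.add_apply, Pi.single_eq_of_ne hj, add_zero] using hm.1 j
  · simpa only [Pi.add_apply, Finset.sum_add_distrib, Finset.sum_pi_single', Finset.mem_univ,
      if_true] using Nat.succ_le_of_lt hn

lemma sum_add_single_mul (m : Fin K → ℕ) (k : Fin K) (w : Fin K → ℝ) :
    ∑ j, ((m + Pi.single k 1 : Fin K → ℕ) j : ℝ) * w j = ∑ j, (m j : ℝ) * w j + w k := by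
  simp only [Pi.add_apply, Nat.cast_add, add_mul, Finset.sum_add_distrib, Pi.single_apply,
    Nat.cast_ite, Nat.cast_one, Nat.cast_zero, ite_mul, one_mul, zero_mul, Finset.sum_ite_eq',
    Finset.mem_univ, if_true]

lemma totalRate_add_single (m : Fin K → ℕ) (k : Fin K) :
    Q.totalRate (m + Pi.single k 1) = Q.totalRate m + Q.serviceRate k :=
  sum_add_single_mul m k Q.serviceRate

lemma costRate_add_single (n : ℕ) (m : Fin K → ℕ) (k : Fin K) :
    Q.costRate n (m + Pi.single k 1) = Q.costRate n m + Q.operatingCost k := by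
  rw [costRate, costRate, sum_add_single_mul, add_assoc]

lemma totalRate_eq_zero_iff (hμ : ∀ k, 0 < Q.serviceRate k) : Q.totalRate m = 0 ↔ m = 0 := by
  rw [totalRate, Finset.sum_eq_zero_iff_of_nonneg fun k _ =>
    mul_nonneg (Nat.cast_nonneg (m k)) (hμ k).le, funext_iff]
  simp only [Finset.mem_univ, true_imp_iff, mul_eq_zero, Nat.cast_eq_zero, (hμ _).ne', or_false,
    Pi.zero_apply]

lemma costRate_zero (n : ℕ) : Q.costRate n 0 = Q.holdingCost n := by
  simp only [costRate, Pi.zero_apply, Nat.cast_zero, zero_mul, Finset.sum_const_zero, add_zero]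

lemma exists_cheapest_server (hμ : ∀ k, 0 < Q.serviceRate k) (hs : ∃ k, 0 < Q.servers k) :
    ∃ k₀, 0 < Q.servers k₀ ∧ ∀ m : Fin K → ℕ, (∀ k, m k ≤ Q.servers k) →
      Q.operatingCost k₀ / Q.serviceRate k₀ * Q.totalRate m ≤
        ∑ k, (m k : ℝ) * Q.operatingCost k := by
  obtain ⟨k₀, hk₀, hmin⟩ := (Set.toFinite {k | 0 < Q.servers k}).exists_minimalFor
    (fun k => Q.operatingCost k / Q.serviceRate k) _ hs
  refine ⟨k₀, hk₀, fun m hm => ?_⟩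
  rw [totalRate, Finset.mul_sum]
  refine Finset.sum_le_sum fun k _ => ?_
  rcases (m k).eq_zero_or_pos with hzero | hpos
  · rw [hzero, Nat.cast_zero, zero_mul, zero_mul, mul_zero]
  · have hratio : Q.operatingCost k₀ / Q.serviceRate k₀ ≤ Q.operatingCost k / Q.serviceRate k :=
      not_lt.1 fun hlt => hlt.not_ge (hmin (hpos.trans_le (hm k)) hlt.le)
    rw [mul_left_comm]
    exact mul_le_mul_of_nonneg_left ((le_div_iff₀ (hμ k)).1 hratio) (Nat.cast_nonneg _)

end Actions

section Recurrence

variable {ν : ℕ → ℝ} {J : ℝ}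

lemma IsStationary.hasSum_mul_totalRate (hd : d ∈ Q.efficientPolicies)
    (hν : Q.IsStationary d ν) : HasSum (fun n => ν n * Q.totalRate (d n)) Q.arrivalRate := by
  have hshift : HasSum (fun n => ν (n + 1) * Q.totalRate (d (n + 1))) Q.arrivalRate := by
    simp_rw [mul_comm (ν _), hν.balance _]
    simpa only [mul_one] using hν.hasSum_one.mul_left Q.arrivalRate
  simpa only [Finset.sum_range_one, totalRate_zero hd, mul_zero, add_zero] using
    (hasSum_nat_add_iff (f := fun n => ν n * Q.totalRate (d n)) 1).1 hshift

variable (hl : 0 < Q.arrivalRate)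
include hl

lemma IsStationary.exists_servers_pos (hd : d ∈ Q.efficientPolicies) (hν : Q.IsStationary d ν) :
    ∃ k, 0 < Q.servers k := by
  by_contra! hs
  have hrate : ∀ n, Q.totalRate (d n) = 0 := fun n => Finset.sum_eq_zero fun k _ => by
    rw [Nat.eq_zero_of_le_zero (((hd n).1 k).trans (hs k)), Nat.cast_zero, zero_mul]
  have hsum := hν.hasSum_mul_totalRate hd
  simp only [hrate, mul_zero] at hsum
  exact hl.ne (hasSum_zero.unique hsum)

lemma HasStationaryCost.holdingCost_add_mul_arrivalRate_lt (hm : Monotone Q.holdingCost)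
    (hinf : Tendsto Q.holdingCost atTop atTop) (hd : d ∈ Q.efficientPolicies)
    (hJ : Q.HasStationaryCost d ν J) {b : ℕ} (hb : ∀ n, n < b → ν n = 0) {θ : ℝ}
    (hθ : ∀ n, θ * Q.totalRate (d n) ≤ ∑ k, (d n k : ℝ) * Q.operatingCost k) :
    Q.holdingCost b + θ * Q.arrivalRate < J := by
  have hlower := (hJ.hasSum_one.mul_left (Q.holdingCost b)).add
    ((hJ.hasSum_mul_totalRate hd).mul_left θ)
  rw [mul_one] at hlower
  have hsplit : ∀ n, Q.holdingCost b * ν n + θ * (ν n * Q.totalRate (d n)) =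
      ν n * (Q.holdingCost b + θ * Q.totalRate (d n)) := fun n => by ring
  simp_rw [hsplit] at hlower
  obtain ⟨i, hi⟩ := hJ.exists_pos
  obtain ⟨N, hN, hiN⟩ :=
    ((hinf.eventually_gt_atTop (Q.holdingCost b)).and (eventually_ge_atTop i)).exists
  refine hasSum_lt (fun n => ?_) ?_ hlower hJ.hasSum_cost (i := N)
  · rcases lt_or_ge n b with hn | hn
    · rw [hb n hn, zero_mul, zero_mul]
    · exact mul_le_mul_of_nonneg_left (add_le_add (hm hn) (hθ n)) (hJ.nonneg n)
  · exact mul_lt_mul_of_pos_left (add_lt_add_of_lt_of_le hN (hθ N))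
      (hJ.balance.pos hl hJ.nonneg hiN hi)

omit hl in
lemma DetailedBalance.update_zero_single (hν : Q.DetailedBalance d ν) {b : ℕ}
    (hb : ∀ n, n ≤ b → ν n = 0) (k : Fin K) :
    Q.DetailedBalance (Function.update (Function.update d b 0) (b + 1) (0 + Pi.single k 1))
      (Function.update (fun n => Q.arrivalRate * ν n) b (Q.serviceRate k * ν (b + 1))) := by
  have hzero : Q.totalRate 0 = 0 := by
    simp only [totalRate, Pi.zero_apply, Nat.cast_zero, zero_mul, Finset.sum_const_zero]
  intro n
  obtain rfl | hn := eq_or_ne n b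
  · rw [Function.update_self, Function.update_self, Function.update_of_ne (Nat.succ_ne_self n),
      totalRate_add_single, hzero, zero_add, mul_left_comm]
  rw [Function.update_of_ne (fun h => hn (Nat.succ_injective h)), Function.update_of_ne hn]
  obtain rfl | hn' := eq_or_ne (n + 1) b
  · rw [Function.update_self, hzero, zero_mul, hb n (Nat.le_succ n), mul_zero, mul_zero]
  · rw [Function.update_of_ne hn', Function.update_of_ne hn', mul_left_comm, hν]

variable (hμ : ∀ k, 0 < Q.serviceRate k)
include hμ

/-- The competitor keeps the state `b` from being transient: it is idle at `b` and uses a single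
server, of group `k`, at `b + 1`. -/
lemma IsOptimal.mul_le_of_transient (hopt : Q.IsOptimal d) (hJ : Q.HasStationaryCost d ν J)
    {b : ℕ} (hb : ∀ n, n ≤ b → ν n = 0) (hb' : 0 < ν (b + 1)) {k : Fin K}
    (hk : 0 < Q.servers k) :
    Q.serviceRate k * J ≤
      Q.serviceRate k * Q.holdingCost b + Q.arrivalRate * Q.operatingCost k := by
  have hidle : d (b + 1) = 0 := (totalRate_eq_zero_iff hμ).1 <| by
    have hflow := hJ.balance b
    rw [hb b le_rfl, mul_zero] at hflow
    exact (mul_eq_zero.1 hflow).resolve_right hb'.ne'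
  have hsingle : 0 + Pi.single k 1 ∈ Q.actions (b + 1) :=
    add_single_mem_actions (zero_mem_actions _) hk (by
      simp only [Pi.zero_apply, Finset.sum_const_zero, Nat.succ_pos])
  have hexcess := hopt.sum_excess_le hl hμ hJ (N := b + 2)
    (update_mem_efficientPolicies
      (update_mem_efficientPolicies hopt.1 (zero_mem_actions b)) hsingle)
    (hJ.balance.update_zero_single hb k)
    ((Function.forall_update_iff _ fun _ x => 0 ≤ x).2
      ⟨mul_nonneg (hμ k).le hb'.le, fun n _ => mul_nonneg hl.le (hJ.nonneg n)⟩)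
    (fun n hn => by
      rw [Function.update_of_ne (by omega), Function.update_of_ne (by omega)])
    hl (fun n hn => Function.update_of_ne (by omega) ..)
  have hbelow : ∀ j ∈ Finset.range b, ν j = 0 := fun j hj => hb j (Finset.mem_range.1 hj).le
  rw [Finset.sum_range_succ, Finset.sum_range_succ, Finset.sum_range_succ, Finset.sum_range_succ,
    Finset.sum_eq_zero fun j hj => by rw [hbelow j hj, zero_mul, mul_zero],
    Finset.sum_eq_zero fun j hj => by
      rw [Function.update_of_ne (Finset.mem_range.1 hj).ne, hbelow j hj, mul_zero, zero_mul],
    hb b le_rfl, hidle, Function.update_self, Function.update_self,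
    Function.update_of_ne (Nat.succ_ne_self b), Function.update_of_ne (Nat.succ_ne_self b).symm,
    Function.update_self, costRate_add_single, costRate_zero, costRate_zero] at hexcess
  refine sub_nonneg.1 (nonneg_of_mul_nonneg_right ?_ hb')
  linarith

/-- If the states up to `b` were transient, the mean cost would exceed the holding cost at `b` plus
the price of the cheapest service; a competitor that does not leave `b` transient does better. -/
theorem IsOptimal.pos_of_hasStationaryCost (hm : Monotone Q.holdingCost)
    (hinf : Tendsto Q.holdingCost atTop atTop) (hopt : Q.IsOptimal d)
    (hJ : Q.HasStationaryCost d ν J) (n : ℕ) : 0 < ν n := by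
  classical
  have hex := hJ.exists_pos
  refine hJ.balance.pos hl hJ.nonneg (Nat.zero_le n) ?_
  have hfirst : ∀ n, n < Nat.find hex → ν n = 0 := fun n hn =>
    (not_lt.1 (Nat.find_min hex hn)).antisymm (hJ.nonneg n)
  have hspec : 0 < ν (Nat.find hex) := Nat.find_spec hex
  rcases hb : Nat.find hex with _ | b
  · rwa [hb] at hspec
  rw [hb] at hfirst hspec
  obtain ⟨k, hk, hcheap⟩ := exists_cheapest_server hμ (hJ.exists_servers_pos hl hopt.1)
  have hupper := hopt.mul_le_of_transient hl hμ hJ (fun n hn => hfirst n (by omega)) hspec hk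
  have hlower := hJ.holdingCost_add_mul_arrivalRate_lt hl hm hinf hopt.1
    (fun n hn => hfirst n (Nat.lt_succ_of_lt hn)) fun n => hcheap (d n) (hopt.1 n).1
  have hscaled := mul_lt_mul_of_pos_left hlower (hμ k)
  rw [mul_add, ← mul_assoc, mul_div_cancel₀ _ (hμ k).ne', mul_comm (Q.operatingCost k)] at hscaled
  exact absurd hupper hscaled.not_ge

end Recurrence

section Bellman

/-- The differences `g n - g (n - 1)` of the solution `g` of the Poisson equation of the policy
`d` with stationary probabilities `ν` and mean cost `J`. At `n = 0` the quotient is `0 / 0 = 0`. -/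
noncomputable def valueDiff (Q : GroupServerQueue K) (d : ℕ → Fin K → ℕ) (ν : ℕ → ℝ) (J : ℝ)
    (n : ℕ) : ℝ :=
  (∑ j ∈ Finset.range n, ν j * (J - Q.costRate j (d j))) / (Q.totalRate (d n) * ν n)

variable {ν : ℕ → ℝ} {J : ℝ}

lemma DetailedBalance.update (hν : Q.DetailedBalance d ν) (n : ℕ) (m : Fin K → ℕ) :
    Q.DetailedBalance (Function.update d (n + 1) m)
      fun j => (if j ≤ n then Q.totalRate m else Q.totalRate (d (n + 1))) * ν j := by
  intro j
  beta_reduce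
  rcases lt_trichotomy j n with hj | rfl | hj
  · rw [Function.update_of_ne (by omega), if_pos (Nat.succ_le_of_lt hj), if_pos hj.le,
      mul_left_comm, hν, mul_left_comm]
  · rw [Function.update_self, if_neg (by omega), if_pos le_rfl, hν, mul_left_comm]
  · rw [Function.update_of_ne (by omega), if_neg (by omega), if_neg (by omega), mul_left_comm, hν,
      mul_left_comm]

variable (hl : 0 < Q.arrivalRate)

section Positive

variable (hpos : ∀ n, 0 < ν n)
include hl hpos

lemma DetailedBalance.totalRate_pos (hν : Q.DetailedBalance d ν) (n : ℕ) :
    0 < Q.totalRate (d (n + 1)) :=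
  pos_of_mul_pos_left ((mul_pos hl (hpos n)).trans_eq (hν n).symm) (hpos (n + 1)).le

lemma DetailedBalance.totalRate_mul_valueDiff (hν : Q.DetailedBalance d ν) (n : ℕ) :
    Q.totalRate (d n) * ν n * Q.valueDiff d ν J n =
      ∑ j ∈ Finset.range n, ν j * (J - Q.costRate j (d j)) := by
  rcases n with _ | n
  · rw [valueDiff, Finset.sum_range_zero, zero_div, mul_zero]
  · exact mul_div_cancel₀ _ (mul_pos (hν.totalRate_pos hl hpos n) (hpos _)).ne'

lemma DetailedBalance.arrivalRate_mul_valueDiff_succ (hν : Q.DetailedBalance d ν) (n : ℕ) :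
    Q.arrivalRate * Q.valueDiff d ν J (n + 1) =
      J - Q.costRate n (d n) + Q.totalRate (d n) * Q.valueDiff d ν J n := by
  have hsucc := hν.totalRate_mul_valueDiff (J := J) hl hpos (n + 1)
  rw [hν, Finset.sum_range_succ, ← hν.totalRate_mul_valueDiff hl hpos n] at hsucc
  refine mul_left_cancel₀ (hpos n).ne' ?_
  linarith

lemma HasStationaryCost.valueDiff_nonneg (hJ : Q.HasStationaryCost d ν J) {n : ℕ}
    (hn : ∀ j, n ≤ j → J ≤ Q.costRate j (d j)) : 0 ≤ Q.valueDiff d ν J n := by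
  rcases n with _ | n
  · rw [valueDiff, Finset.sum_range_zero, zero_div]
  have hsum : HasSum (fun j => ν j * (J - Q.costRate j (d j))) 0 := by
    simpa only [mul_sub, one_mul, sub_self] using (hJ.hasSum_one.mul_right J).sub hJ.hasSum_cost
  refine div_nonneg ?_ (mul_pos (hJ.balance.totalRate_pos hl hpos n) (hpos _)).le
  rw [← neg_nonpos, ← Finset.sum_neg_distrib]
  refine (sum_le_hasSum _ (fun j hj => ?_) hsum.neg).trans_eq neg_zero
  rw [← mul_neg, neg_sub]
  exact mul_nonneg (hpos j).le (sub_nonneg.2 (hn j (by simpa using hj)))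

lemma HasStationaryCost.eventually_valueDiff_nonneg (hinf : Tendsto Q.holdingCost atTop atTop)
    (hd : d ∈ Q.efficientPolicies) (hJ : Q.HasStationaryCost d ν J) :
    ∀ᶠ n in atTop, 0 ≤ Q.valueDiff d ν J n :=
  (eventually_forall_ge_atTop.2 (tendsto_atTop.1 (tendsto_costRate hd hinf) J)).mono fun _ hn =>
    hJ.valueDiff_nonneg hl hpos hn

end Positive

variable (hμ : ∀ k, 0 < Q.serviceRate k) (hopt : Q.IsOptimal d) (hJ : Q.HasStationaryCost d ν J)
  (hpos : ∀ n, 0 < ν n)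
include hl hμ hopt hJ hpos

theorem IsOptimal.bellman_le {n : ℕ} {m : Fin K → ℕ} (hm : m ∈ Q.actions n) :
    Q.costRate n (d n) - Q.totalRate (d n) * Q.valueDiff d ν J n ≤
      Q.costRate n m - Q.totalRate m * Q.valueDiff d ν J n := by
  rcases n with _ | n
  · rw [eq_zero_of_mem_actions_zero hm, eq_zero_of_mem_actions_zero (hopt.1 0)]
  have hr := hJ.balance.totalRate_pos hl hpos n
  have hG := hJ.balance.totalRate_mul_valueDiff (J := J) hl hpos (n + 1)
  have hexcess := hopt.sum_excess_le hl hμ hJ (update_mem_efficientPolicies hopt.1 hm)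
    (hJ.balance.update n m)
    (fun j => mul_nonneg (by split_ifs <;> exact totalRate_nonneg hμ _) (hJ.nonneg j))
    (N := n + 2) (fun j hj => Function.update_of_ne (by omega) ..) hr
    (fun j hj => by rw [if_neg (by omega)])
  have hbelow : ∑ j ∈ Finset.range (n + 1),
      (if j ≤ n then Q.totalRate m else Q.totalRate (d (n + 1))) * ν j *
        (Q.costRate j (Function.update d (n + 1) m j) - J) =
      -Q.totalRate m * ∑ j ∈ Finset.range (n + 1), ν j * (J - Q.costRate j (d j)) := by
    rw [Finset.mul_sum]
    refine Finset.sum_congr rfl fun j hj => ?_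
    have hjn := Finset.mem_range.1 hj
    rw [if_pos (by omega), Function.update_of_ne (by omega)]
    ring
  have hbelow' : ∑ j ∈ Finset.range (n + 1),
      Q.totalRate (d (n + 1)) * (ν j * (Q.costRate j (d j) - J)) =
      -Q.totalRate (d (n + 1)) *
        ∑ j ∈ Finset.range (n + 1), ν j * (J - Q.costRate j (d j)) := by
    rw [Finset.mul_sum]
    exact Finset.sum_congr rfl fun j _ => by ring
  rw [Finset.sum_range_succ, Finset.sum_range_succ _ (n + 1), hbelow, hbelow', ← hG,
    if_neg (by omega), Function.update_self] at hexcess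
  refine le_of_mul_le_mul_left ?_ (mul_pos hr (hpos (n + 1)))
  linarith

lemma IsOptimal.arrivalRate_mul_valueDiff_sub_le {n : ℕ} (hn : ∑ k, Q.servers k ≤ n) :
    Q.arrivalRate * (Q.valueDiff d ν J (n + 2) - Q.valueDiff d ν J (n + 1)) ≤
      Q.totalRate (d (n + 1)) * (Q.valueDiff d ν J (n + 1) - Q.valueDiff d ν J n) -
        (Q.holdingCost (n + 1) - Q.holdingCost n) := by
  have hsucc := hJ.balance.arrivalRate_mul_valueDiff_succ (J := J) hl hpos (n + 1)
  have hcurr := hJ.balance.arrivalRate_mul_valueDiff_succ (J := J) hl hpos n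
  have hmem : d (n + 1) ∈ Q.actions n :=
    ⟨(hopt.1 (n + 1)).1, (Finset.sum_le_sum fun k _ => (hopt.1 (n + 1)).1 k).trans hn⟩
  have hbellman := hopt.bellman_le hl hμ hJ hpos hmem
  have hcost : Q.costRate n (d (n + 1)) =
      Q.costRate (n + 1) (d (n + 1)) - (Q.holdingCost (n + 1) - Q.holdingCost n) := by
    rw [costRate, costRate]; ring
  rw [hcost] at hbellman
  linarith

/-- Once `valueDiff` fails to increase, it decreases at least as fast as `holdingCost` grows, and
so becomes negative. -/
theorem IsOptimal.valueDiff_lt_succ (hm : Monotone Q.holdingCost)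
    (hinf : Tendsto Q.holdingCost atTop atTop) {n : ℕ} (hn : ∑ k, Q.servers k ≤ n) :
    Q.valueDiff d ν J n < Q.valueDiff d ν J (n + 1) := by
  by_contra! hle
  have hdecr : ∀ j, n ≤ j → Q.valueDiff d ν J (j + 1) ≤ Q.valueDiff d ν J j ∧
      Q.arrivalRate * Q.valueDiff d ν J (j + 1) + Q.holdingCost j ≤
        Q.arrivalRate * Q.valueDiff d ν J (n + 1) + Q.holdingCost n := by
    intro j hj
    induction j, hj using Nat.le_induction with
    | base => exact ⟨hle, le_rfl⟩
    | succ j hj ih =>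
      have hstep := hopt.arrivalRate_mul_valueDiff_sub_le hl hμ hJ hpos (hn.trans hj)
      have hdrop := mul_nonpos_of_nonneg_of_nonpos (totalRate_nonneg hμ (d (j + 1)))
        (sub_nonpos.2 ih.1)
      have hgrow := hm (Nat.le_succ j)
      exact ⟨le_of_mul_le_mul_left (by linarith) hl, by linarith [ih.2]⟩
  obtain ⟨j, hj, hnj, hnonneg⟩ := ((hinf.eventually_gt_atTop
    (Q.arrivalRate * Q.valueDiff d ν J (n + 1) + Q.holdingCost n)).and
    ((eventually_ge_atTop n).and ((tendsto_add_atTop_nat 1).eventually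
      (hJ.eventually_valueDiff_nonneg hl hpos hinf hopt.1)))).exists
  linarith [(hdecr j hnj).2, mul_nonneg hl.le hnonneg]

theorem IsOptimal.strictMonoOn_valueDiff (hm : Monotone Q.holdingCost)
    (hinf : Tendsto Q.holdingCost atTop atTop) :
    StrictMonoOn (Q.valueDiff d ν J) (Set.Ici (∑ k, Q.servers k)) :=
  strictMonoOn_of_lt_succ Set.ordConnected_Ici fun _ _ hn _ =>
    hopt.valueDiff_lt_succ hl hμ hJ hpos hm hinf hn

lemma IsOptimal.operatingCost_le {n : ℕ} {k : Fin K} (hk : 0 < d n k) :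
    Q.operatingCost k ≤ Q.serviceRate k * Q.valueDiff d ν J n := by
  obtain ⟨m, hm⟩ : ∃ m, d n = m + Pi.single k 1 := ⟨d n - Pi.single k 1, funext fun j => by
    obtain rfl | hj := eq_or_ne j k
    · simpa only [Pi.add_apply, Pi.sub_apply, Pi.single_eq_same] using (Nat.sub_add_cancel hk).symm
    · simp only [Pi.add_apply, Pi.sub_apply, Pi.single_eq_of_ne hj, Nat.sub_zero, add_zero]⟩
  have hbellman := hopt.bellman_le hl hμ hJ hpos
    (mem_actions_of_le (hopt.1 n) (hm ▸ le_self_add : m ≤ d n))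
  rw [hm, costRate_add_single, totalRate_add_single] at hbellman
  linarith

lemma IsOptimal.le_operatingCost {n : ℕ} {k : Fin K} (hk : d n k < Q.servers k)
    (hn : ∑ k, d n k < n) : Q.serviceRate k * Q.valueDiff d ν J n ≤ Q.operatingCost k := by
  have hbellman := hopt.bellman_le hl hμ hJ hpos (add_single_mem_actions (hopt.1 n) hk hn)
  rw [costRate_add_single, totalRate_add_single] at hbellman
  linarith

end Bellman

section Truncation

theorem IsOptimal.eq_servers (hl : 0 < Q.arrivalRate) (hμ : ∀ k, 0 < Q.serviceRate k)
    (hm : Monotone Q.holdingCost) (hinf : Tendsto Q.holdingCost atTop atTop)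
    (hopt : Q.IsOptimal d) {N : ℕ} (hN : ∀ k, d N k = Q.servers k) {n : ℕ} (hn : N ≤ n)
    (k : Fin K) : d n k = Q.servers k := by
  refine ((hopt.1 n).1 k).eq_of_not_lt fun hlt => ?_
  have hNn : N < n := hn.lt_of_ne fun h => hlt.ne (h ▸ hN k)
  have hservers : ∑ k, Q.servers k ≤ N := by simpa only [hN] using (hopt.1 N).2
  have hfree : ∑ k, d n k < n :=
    (Finset.sum_le_sum fun k _ => (hopt.1 n).1 k).trans_lt (hservers.trans_lt hNn)
  obtain ⟨η, hη, -⟩ := hopt.2 0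
  obtain ⟨ν, J, hJ⟩ := hη.exists_hasStationaryCost hl hμ hopt.1 hinf
  have hpos := hopt.pos_of_hasStationaryCost hl hμ hm hinf hJ
  have hon := hopt.operatingCost_le hl hμ hJ hpos ((Nat.zero_lt_of_lt hlt).trans_eq (hN k).symm)
  have hoff := hopt.le_operatingCost hl hμ hJ hpos hlt hfree
  have hincr := hopt.strictMonoOn_valueDiff hl hμ hJ hpos hm hinf hservers (hservers.trans hn) hNn
  exact ((hon.trans_lt (mul_lt_mul_of_pos_left hincr (hμ k))).trans_le hoff).false

lemma finite_truncatedPolicies (Q : GroupServerQueue K) (N : ℕ) :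
    (Q.truncatedPolicies N).Finite := by
  let restrict (d : Q.truncatedPolicies N) (n : Fin N) (k : Fin K) : Fin (Q.servers k + 1) :=
    ⟨d.1 n k, Nat.lt_succ_of_le ((d.2.1 n).1 k)⟩
  refine Set.finite_coe_iff.1 (Finite.of_injective restrict fun d d' h => ?_)
  ext n k
  rcases lt_or_ge n N with hn | hn
  · exact congrArg Fin.val (congrFun (congrFun h ⟨n, hn⟩) k)
  · rw [d.2.2 n hn k, d'.2.2 n hn k]

lemma IsOptimalIn.of_subset {D D' : Set (ℕ → Fin K → ℕ)} {d' : ℕ → Fin K → ℕ}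
    (hd : Q.IsOptimalIn D d) (hsub : D' ⊆ D) (hmem : d ∈ D') (hd' : Q.IsOptimalIn D' d') :
    Q.IsOptimalIn D d' := by
  refine ⟨hsub hd'.1, fun i => ?_⟩
  obtain ⟨η, hη, hmin⟩ := hd.2 i
  obtain ⟨η', hη', hmin'⟩ := hd'.2 i
  exact ⟨η', hη', fun e he ξ hξ => (hmin' d hmem η hη).trans (hmin e he ξ hξ)⟩

end Truncation

end GroupServerQueue

theorem corollary1_general {K : ℕ} (Q : GroupServerQueue K)
    (h_arrival : 0 < Q.arrivalRate)
    (h_service : ∀ k, 0 < Q.serviceRate k)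
    (h_mono : Monotone Q.holdingCost)
    (h_infty : Tendsto Q.holdingCost atTop atTop)
    (dstar : ℕ → Fin K → ℕ) (h_opt : Q.IsOptimal dstar)
    (nbar : ℕ) (h_full : ∀ k, dstar nbar k = Q.servers k) :
    (∀ n, nbar ≤ n → ∀ k, dstar n k = Q.servers k) ∧
      (Q.truncatedPolicies nbar).Finite ∧
      ∀ d, Q.IsOptimalIn (Q.truncatedPolicies nbar) d → Q.IsOptimal d := by
  have htail : ∀ n, nbar ≤ n → ∀ k, dstar n k = Q.servers k := fun n hn =>
    h_opt.eq_servers h_arrival h_service h_mono h_infty h_full hn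
  exact ⟨htail, Q.finite_truncatedPolicies nbar, fun d =>
    GroupServerQueue.IsOptimalIn.of_subset h_opt (fun _ he => he.1) ⟨h_opt.1, htail⟩⟩

theorem corollary1 {K : ℕ} (Q : GroupServerQueue K)
    (h_arrival : 0 < Q.arrivalRate)
    (h_service : ∀ k, 0 < Q.serviceRate k)
    (h_cost : ∀ k, 0 ≤ Q.operatingCost k)
    (h_mono : Monotone Q.holdingCost)
    (h_convex : ∀ n, 2 * Q.holdingCost (n + 1) ≤ Q.holdingCost n + Q.holdingCost (n + 2))
    (h_infty : Tendsto Q.holdingCost atTop atTop)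
    (dstar : ℕ → Fin K → ℕ) (h_opt : Q.IsOptimal dstar)
    (nbar : ℕ) (h_full : ∀ k, dstar nbar k = Q.servers k) :
    (∀ n, nbar ≤ n → ∀ k, dstar n k = Q.servers k) ∧
      (Q.truncatedPolicies nbar).Finite ∧
      ∀ d, Q.IsOptimalIn (Q.truncatedPolicies nbar) d → Q.IsOptimal d :=
  corollary1_general Q h_arrival h_service h_mono h_infty dstar h_opt nbar h_full
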